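/- **Definitions.** For a finite simple graph $G=(V,E)$ and $A\subseteq V$ let $I_G(A)$ be the set of edges of $G$ with both ends in $A$. The set $A$ is *optimal* if $|I_G(A)|=\max\{|I_G(S)| : S\subseteq V,\ |S|=|A|\}$. A total order on $V$ is *optimal* for $G$ if all its initial segments are optimal; $G$ is *isoperimetric* if it has an optimal order. Let $G_1,\dots,G_d$ be isoperimetric graphs with vertex sets $V_1,\dots,V_d$ and fixed optimal orders $\eta_i:V_i\to\{1,\dots,|V_i|\}$, and for $S=\{i_1<\dots<i_k\}\subseteq\{1,\dots,d\}$ let $G_S=G_{i_1}\square\cdots\square G_{i_k}$ be the Cartesian product, $G=G_{\{1,\dots,d\}}$. The *lexicographic order* $\mathcal L_{G_S}^{k}$ compares $u,v\in V(G_S)$ by comparing $(\eta_{i_1}(u_{1}),\dots,\eta_{i_k}(u_{k}))$ and $(\eta_{i_1}(v_{1}),\dots,\eta_{i_k}(v_{k}))$ lexicographically. For a permutation $\pi$ of the $k$ coordinates, the *domination order* of $\pi$ compares these tuples lexicographically after their coordinates have been permuted by $\pi$. Given a partition of each $V_i$ into nonempty intervals of $\eta_i$, a *block* of $G_S$ is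 a product of parts, one of each $V_{i_j}$; its *start* is the tuple of the first vertices of these parts. Given also a permutation for every block, the *block-lexicographic order* $\mathcal{BL}_{G_S}^{k}$ compares two vertices of the same block in the domination order of that block's permutation, and two vertices of different blocks as their starts are compared in $\mathcal L_{G_S}^{k}$. The *atomic partition* of $V_i$ is the one into single vertices. **Corollary.** Let $d\ge 3$, let $G_1,\dots,G_d$ be isoperimetric graphs with optimal orders $\eta_1,\dots,\eta_d$, let $G=G_1\square\cdots\square G_d$, and let $\mathcal{BL}_{G_S}^{|S|}$, $S\subseteq\{1,\dots,d\}$, be the block-lexicographic orders based on the atomic partitions, for any choice of the permutations of the blocks. 1. For every $S\subseteq\{1,\dots,d\}$ the order $\mathcal{BL}_{G_S}^{|S|}$ is the lexicographic order $\mathcal L_{G_S}^{|S|}$. 2. If $\mathcal{BL}_{G_i\square G_j}^{2}$ is optimal for all $1\le i<j\le d$, then $\mathcal{BL}_G^d$ is optimal. 3. Consequently (the Ahlswede–Cai local-global principle), if $\mathcal L_{G_i\square G_j}^{2}$ is optimal for all $1\le i<j\le d$, then $\mathcal L_G^d$ is optimal. -/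

import Mathlib

universe u

namespace EdgeIso

section Graph

variable {V : Type u}

/-- `I_G(A, B)`: the edges of `G` joining a vertex of `A` to a vertex of `B`. -/
def edgesBetween (G : SimpleGraph V) (A B : Finset V) : Set (Sym2 V) :=
  {e | e ∈ G.edgeSet ∧ ∃ x ∈ A, ∃ y ∈ B, e = s(x, y)}

/-- `|I_G(A)|`: the number of edges of `G` with both ends in `A`. -/
noncomputable def numInduced (G : SimpleGraph V) (A : Finset V) : ℕ :=
  (edgesBetween G A A).ncard

/-- `I_G(m)`: the maximum of `|I_G(S)|` over the vertex sets `S` of size `m`. -/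
noncomputable def maxInduced [Fintype V] (G : SimpleGraph V) (m : ℕ) : ℕ :=
  ((Finset.univ : Finset V).powersetCard m).sup (numInduced G)

/-- `A` is optimal: it induces as many edges as any vertex set of its size. -/
def IsOptimalSet [Fintype V] (G : SimpleGraph V) (A : Finset V) : Prop :=
  maxInduced G A.card = numInduced G A

/-- `A` is an initial segment of the order `lt`. -/
def IsInitialSegment (lt : V → V → Prop) (A : Finset V) : Prop :=
  ∀ x y, lt x y → y ∈ A → x ∈ A

/-- `lt` is an optimal order on `G`: a (strict) total order on the vertices, all of whose
initial segments are optimal, so that they form a chain of nested solutions. -/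
def IsOptimalOrder [Fintype V] (G : SimpleGraph V) (lt : V → V → Prop) : Prop :=
  IsStrictTotalOrder V lt ∧ ∀ A : Finset V, IsInitialSegment lt A → IsOptimalSet G A

/-- A total order on the vertex set, given as a numbering of the vertices. -/
abbrev VertexOrder (V : Type u) [Fintype V] : Type u := V ≃ Fin (Fintype.card V)

/-- The strict order `x <_η y` of a vertex order given as a numbering. -/
def VertexOrder.lt [Fintype V] (η : VertexOrder V) (x y : V) : Prop := η x < η y

/-- A partition of the vertex set into nonempty intervals of the order `η`. -/
structure IntervalPartition [Fintype V] [DecidableEq V] (η : VertexOrder V) where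
  toFinpartition : Finpartition (Finset.univ : Finset V)
  interval : ∀ Z ∈ toFinpartition.parts, ∀ x ∈ Z, ∀ z ∈ Z, ∀ y : V,
    η x ≤ η y → η y ≤ η z → y ∈ Z

/-- The part that contains the vertex `v`. -/
def IntervalPartition.part [Fintype V] [DecidableEq V] {η : VertexOrder V}
    (P : IntervalPartition η) (v : V) : Finset V :=
  P.toFinpartition.part v

/-- The start (the `η`-first vertex) of the part that contains `v`. -/
def IntervalPartition.start [Fintype V] [DecidableEq V] {η : VertexOrder V}
    (P : IntervalPartition η) (v : V) : V :=
  η.symm ((P.part v).inf' ⟨v, P.toFinpartition.mem_part (Finset.mem_univ v)⟩ η)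

/-- The atomic partition: every part is a single vertex. -/
def atomicPartition [Fintype V] [DecidableEq V] (η : VertexOrder V) : IntervalPartition η where
  toFinpartition := ⊥
  interval := by
    intro Z hZ x hx z hz y hxy hyz
    obtain ⟨a, -, rfl⟩ := Finpartition.mem_bot_iff.1 hZ
    rw [Finset.mem_singleton] at hx hz ⊢
    subst hx hz
    exact η.injective (le_antisymm hyz hxy)

end Graph

section Product

variable {ι : Type} {V : ι → Type u}

/-- The Cartesian product of the graphs `G i`: adjacent tuples differ in exactly one
coordinate, and there they are adjacent. -/
def cartesianProduct (G : ∀ i, SimpleGraph (V i)) : SimpleGraph (∀ i, V i) where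
  Adj x y := ∃ i, (G i).Adj (x i) (y i) ∧ ∀ j, j ≠ i → x j = y j
  symm := ⟨fun _ _ ⟨i, h, h'⟩ => ⟨i, h.symm, fun j hj => (h' j hj).symm⟩⟩
  loopless := ⟨fun _ ⟨i, h, _⟩ => (G i).loopless.irrefl _ h⟩

/-- The subproduct `G_S`, for a set `S` of coordinates. -/
def subproduct (G : ∀ i, SimpleGraph (V i)) (S : Finset ι) :
    SimpleGraph (∀ i : S, V i) :=
  cartesianProduct fun i : S => G i

variable [LinearOrder ι]

/-- The lexicographic order on `ℝ^ι`, coordinates being compared in the order of `ι`. -/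
def realLexLT (x y : ι → ℝ) : Prop :=
  ∃ i, (∀ j, j < i → x j = y j) ∧ x i < y i

/-- The domination order on `ℝ^ι` of a permutation `π`: the lexicographic order after the
coordinates have been permuted by `π`. -/
def realDominationLT (π : Equiv.Perm ι) (x y : ι → ℝ) : Prop :=
  realLexLT (fun i => x (π i)) (fun i => y (π i))

variable [∀ i, Fintype (V i)]

/-- The tuple `(η_i(v_i))_i`, with each `η_i` numbering its vertices from `1`. -/
def position (η : ∀ i, VertexOrder (V i)) (v : ∀ i, V i) : ι → ℝ :=
  fun i => (((η i (v i) : ℕ) + 1 : ℕ) : ℝ)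

/-- The order on the vertices of the product that an order on `ℝ^ι` induces. -/
def inducedLT (lt : (ι → ℝ) → (ι → ℝ) → Prop) (η : ∀ i, VertexOrder (V i))
    (x y : ∀ i, V i) : Prop :=
  lt (position η x) (position η y)

/-- The lexicographic order on the product. -/
def lexLT (η : ∀ i, VertexOrder (V i)) : (∀ i, V i) → (∀ i, V i) → Prop :=
  inducedLT realLexLT η

variable [∀ i, DecidableEq (V i)]

/-- The block that contains the vertex `v` of the product, as the tuple of its sides. -/
def block {η : ∀ i, VertexOrder (V i)} (P : ∀ i, IntervalPartition (η i))
    (v : ∀ i, V i) : ∀ i, Finset (V i) :=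
  fun i => (P i).part (v i)

/-- The start of the block that contains the vertex `v` of the product. -/
def blockStart {η : ∀ i, VertexOrder (V i)} (P : ∀ i, IntervalPartition (η i))
    (v : ∀ i, V i) : ∀ i, V i :=
  fun i => (P i).start (v i)

/-- The block-lexicographic order on the product, for partitions `P i` and a choice `D` of
a permutation for every block. Two vertices of the same block `B` are compared in the
domination order of `D B`; vertices of different blocks are compared as the starts of their
blocks are in the lexicographic order. -/
def blockLexLT (η : ∀ i, VertexOrder (V i)) (P : ∀ i, IntervalPartition (η i))
    (D : (∀ i, Finset (V i)) → Equiv.Perm ι) (x y : ∀ i, V i) : Prop :=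
  (block P x = block P y ∧ inducedLT (realDominationLT (D (block P x))) η x y) ∨
  (block P x ≠ block P y ∧ lexLT η (blockStart P x) (blockStart P y))

/-- The lexicographic order on the subproduct `G_S`. -/
def subLexLT (η : ∀ i, VertexOrder (V i)) (S : Finset ι) :
    (∀ i : S, V i) → (∀ i : S, V i) → Prop :=
  lexLT fun i : S => η i

/-- The block-lexicographic order on the subproduct `G_S` based on the atomic partitions;
`D S B` is the permutation of the domination order on the block `B` of `G_S`. -/
def atomicBlockLexLT (η : ∀ i, VertexOrder (V i))
    (D : ∀ S : Finset ι, (∀ i : S, Finset (V i)) → Equiv.Perm S) (S : Finset ι) :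
    (∀ i : S, V i) → (∀ i : S, V i) → Prop :=
  blockLexLT (fun i : S => η i) (fun i : S => atomicPartition (η i)) (D S)

end Product

end EdgeIso

/-! With atomic partitions every block is a single vertex and is its own start, so `BL` is the
lexicographic order and the first claim holds (`blockLexLT_atomicPartition`). The other two claims
both become the local-global principle for the lexicographic order.

That principle is proved by induction on the number of free coordinates. All subproducts are
realized as slices of the full product (`slice`), so coordinates can be fixed without changing
types. Let `S` have at least three coordinates and suppose that slices with one coordinate fewer are
optimal. Among the sets of a given size in a slice over `S`, take an edge-maximal one, `A`, and
among those the colexicographically least. Compression replaces each section of `A` by an initial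
segment of the same size and loses no edges (`exists_compression`), so `A` is already compressed in
every direction.

If `A` is not an initial segment, let `a` be its first missing and `b` its last present tuple. With
`m` and `l` the first and last coordinates of `S`, compression forces `b m` to succeed `a m`
immediately, `b l < a l`, and every middle coordinate to be maximal in `a` and minimal in `b`
(`compressed_gap`). So the change from `A` to an initial segment is essentially two-dimensional.
Optimality in the coordinates `m`, `l` supplies an exchange that loses no edges and makes `A`
colexicographically smaller (`exists_exchange`), a contradiction. -/

namespace EdgeIso

/-! ### Counting edges as ordered adjacent pairs -/

section EdgeCount

variable {α : Type*} {β : Type*}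

open Classical in
/-- The number of pairs `(x, y) ∈ A × B` with `x` and `y` adjacent. -/
noncomputable def edgeCount (G : SimpleGraph α) (A B : Finset α) : ℕ :=
  ∑ x ∈ A, ∑ y ∈ B, if G.Adj x y then 1 else 0

theorem edgeCount_comm (G : SimpleGraph α) (A B : Finset α) :
    edgeCount G A B = edgeCount G B A := by
  unfold edgeCount
  rw [Finset.sum_comm]
  refine Finset.sum_congr rfl fun y _ => Finset.sum_congr rfl fun x _ => ?_
  rw [G.adj_comm]

theorem edgeCount_union_left [DecidableEq α] (G : SimpleGraph α) {A B : Finset α}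
    (h : Disjoint A B) (C : Finset α) :
    edgeCount G (A ∪ B) C = edgeCount G A C + edgeCount G B C :=
  Finset.sum_union h

theorem edgeCount_union_self [DecidableEq α] (G : SimpleGraph α) {A B : Finset α}
    (h : Disjoint A B) :
    edgeCount G (A ∪ B) (A ∪ B) =
      edgeCount G A A + 2 * edgeCount G A B + edgeCount G B B := by
  rw [edgeCount_union_left G h, edgeCount_comm G A, edgeCount_comm G B,
    edgeCount_union_left G h, edgeCount_union_left G h, edgeCount_comm G B A]
  ring

theorem edgeCount_eq_card (G : SimpleGraph α) (A B : Finset α)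
    [DecidablePred fun q : α × α => G.Adj q.1 q.2] :
    edgeCount G A B = ((A ×ˢ B).filter fun q => G.Adj q.1 q.2).card := by
  rw [Finset.card_filter, Finset.sum_product]
  unfold edgeCount
  congr! 4

theorem edgeCount_le_edgeCount {G : SimpleGraph α} {H : SimpleGraph β} {A B : Finset α}
    {A' B' : Finset β} (f g : α → β)
    (hf : ∀ x ∈ A, ∀ x' ∈ A, f x = f x' → x = x') (hg : ∀ x ∈ B, ∀ x' ∈ B, g x = g x' → x = x')
    (h : ∀ x ∈ A, ∀ y ∈ B, G.Adj x y → f x ∈ A' ∧ g y ∈ B' ∧ H.Adj (f x) (g y)) :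
    edgeCount G A B ≤ edgeCount H A' B' := by
  classical
  rw [edgeCount_eq_card, edgeCount_eq_card]
  refine Finset.card_le_card_of_injOn (fun q => (f q.1, g q.2)) ?_ ?_
  · intro q hq
    simp only [Finset.coe_filter, Finset.mem_product, Set.mem_ofPred_eq] at hq ⊢
    obtain ⟨h1, h2, h3⟩ := h _ hq.1.1 _ hq.1.2 hq.2
    exact ⟨⟨h1, h2⟩, h3⟩
  · intro q hq q' hq' hqq
    simp only [Finset.coe_filter, Finset.mem_product, Set.mem_ofPred_eq, Prod.mk.injEq]
      at hq hq' hqq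
    exact Prod.ext (hf _ hq.1.1 _ hq'.1.1 hqq.1) (hg _ hq.1.2 _ hq'.1.2 hqq.2)

theorem edgeCount_map {G : SimpleGraph α} {H : SimpleGraph β} (f : α ↪ β)
    (hf : ∀ x y, H.Adj (f x) (f y) ↔ G.Adj x y) (A B : Finset α) :
    edgeCount H (A.map f) (B.map f) = edgeCount G A B := by
  simp only [edgeCount, Finset.sum_map]
  congr! 5
  exact hf _ _

theorem edgeCount_fiberwise {κ : Type*} [Fintype κ] [DecidableEq κ] (G : SimpleGraph α)
    (f : α → κ) (A B : Finset α) :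
    edgeCount G A B = ∑ v, ∑ w, edgeCount G (A.filter (f · = v)) (B.filter (f · = w)) := by
  classical
  unfold edgeCount
  rw [← Finset.sum_fiberwise A f fun x => ∑ y ∈ B, if G.Adj x y then 1 else 0]
  refine Finset.sum_congr rfl fun v _ => ?_
  rw [Finset.sum_comm (s := Finset.univ)]
  refine Finset.sum_congr rfl fun x _ => ?_
  rw [Finset.sum_fiberwise B f fun y => if G.Adj x y then 1 else 0]

theorem two_mul_numInduced (G : SimpleGraph α) (A : Finset α) :
    2 * numInduced G A = edgeCount G A A := by
  classical
  rw [edgeCount_eq_card]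
  set P := (A ×ˢ A).filter fun q => G.Adj q.1 q.2 with hP
  have hE : edgesBetween G A A = ↑(P.image fun q => s(q.1, q.2)) := by
    ext e
    simp only [edgesBetween, Set.mem_ofPred_eq, Finset.coe_image, Set.mem_image, hP,
      Finset.coe_filter, Finset.mem_product, Prod.exists]
    constructor
    · rintro ⟨he, x, hx, y, hy, rfl⟩
      exact ⟨x, y, ⟨⟨hx, hy⟩, he⟩, rfl⟩
    · rintro ⟨x, y, ⟨⟨hx, hy⟩, he⟩, rfl⟩
      exact ⟨he, x, hx, y, hy, rfl⟩
  unfold numInduced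
  rw [hE, Set.ncard_coe_finset, Finset.card_eq_sum_card_image (fun q : α × α => s(q.1, q.2)) P,
    Finset.sum_const_nat (m := 2), mul_comm]
  intro e he
  obtain ⟨⟨x, y⟩, hq, rfl⟩ := Finset.mem_image.1 he
  simp only [hP, Finset.mem_filter, Finset.mem_product] at hq
  rw [show (P.filter fun q => s(q.1, q.2) = s(x, y)) = {(x, y), (y, x)} by
    ext ⟨z, w⟩
    simp only [hP, Finset.mem_filter, Finset.mem_product, Sym2.eq_iff, Finset.mem_insert,
      Finset.mem_singleton, Prod.mk.injEq]
    constructor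
    · exact fun h => h.2
    · rintro (⟨rfl, rfl⟩ | ⟨rfl, rfl⟩)
      · exact ⟨hq, Or.inl ⟨rfl, rfl⟩⟩
      · exact ⟨⟨⟨hq.1.2, hq.1.1⟩, hq.2.symm⟩, Or.inr ⟨rfl, rfl⟩⟩]
  exact Finset.card_pair fun h => hq.2.ne (Prod.mk.inj h).1

end EdgeCount

/-! ### Initial segments and extremal sets -/

section Initial

variable {α : Type*} {β : Type*}

/-- `B` is an initial segment of `W` with respect to `lt`. -/
def IsInitialIn (lt : α → α → Prop) (W : Set α) (B : Finset α) : Prop :=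
  ∀ x ∈ W, ∀ y ∈ B, lt x y → x ∈ B

/-- Within `W`, initial segments of `lt` induce the most edges among the sets of their size. -/
def IsOptimalOn (G : SimpleGraph α) (lt : α → α → Prop) (W : Set α) : Prop :=
  ∀ A B : Finset α, ↑A ⊆ W → ↑B ⊆ W → IsInitialIn lt W B → A.card = B.card →
    edgeCount G A A ≤ edgeCount G B B

theorem isOptimalOrder_iff [Fintype α] (G : SimpleGraph α) (lt : α → α → Prop) :
    IsOptimalOrder G lt ↔ IsStrictTotalOrder α lt ∧ IsOptimalOn G lt Set.univ := by
  refine and_congr_right fun _ => ⟨fun h A B _ _ hB hAB => ?_, fun h B hB => ?_⟩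
  · rw [← two_mul_numInduced, ← two_mul_numInduced,
      ← h B fun x y hxy hy => hB x trivial y hy hxy]
    exact Nat.mul_le_mul_left _ (Finset.le_sup (f := numInduced G)
      (Finset.mem_powersetCard.2 ⟨Finset.subset_univ _, hAB⟩))
  · refine le_antisymm (Finset.sup_le fun A hA => ?_)
      (Finset.le_sup (f := numInduced G) (Finset.mem_powersetCard.2 ⟨Finset.subset_univ _, rfl⟩))
    have := h A B (Set.subset_univ _) (Set.subset_univ _) (fun x _ y hy hxy => hB x y hxy hy)
      (Finset.mem_powersetCard.1 hA).2
    rw [← two_mul_numInduced, ← two_mul_numInduced] at this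
    omega

theorem isOptimalOn_range_iff {G : SimpleGraph α} {H : SimpleGraph β} {lt : α → α → Prop}
    {lt' : β → β → Prop} (f : α ↪ β) (hf : ∀ x y, H.Adj (f x) (f y) ↔ G.Adj x y)
    (hlt : ∀ x y, lt' (f x) (f y) ↔ lt x y) :
    IsOptimalOn H lt' (Set.range f) ↔ IsOptimalOn G lt Set.univ := by
  have hmap : ∀ A : Finset β, ↑A ⊆ Set.range f → ∃ A' : Finset α, A'.map f = A := by
    intro A hA
    refine ⟨A.preimage f f.injective.injOn, ?_⟩
    ext y
    simp only [Finset.mem_map, Finset.mem_preimage]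
    constructor
    · rintro ⟨x, hx, rfl⟩
      exact hx
    · intro hy
      obtain ⟨x, rfl⟩ := hA hy
      exact ⟨x, hy, rfl⟩
  have hinit : ∀ B : Finset α, IsInitialIn lt' (Set.range f) (B.map f) ↔
      IsInitialIn lt Set.univ B := by
    intro B
    constructor
    · intro h x _ y hy hxy
      have := h (f x) ⟨x, rfl⟩ (f y) (Finset.mem_map_of_mem f hy) ((hlt _ _).2 hxy)
      simpa using this
    · rintro h _ ⟨x, rfl⟩ y' hy' hxy
      obtain ⟨y, hy, rfl⟩ := Finset.mem_map.1 hy'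
      exact Finset.mem_map_of_mem f (h x trivial y hy ((hlt _ _).1 hxy))
  constructor
  · intro h A B _ _ hB hAB
    have := h (A.map f) (B.map f) (by simp) (by simp) ((hinit B).2 hB) (by simpa using hAB)
    rwa [edgeCount_map f hf, edgeCount_map f hf] at this
  · intro h A B hA hB hBi hAB
    obtain ⟨A, rfl⟩ := hmap A hA
    obtain ⟨B, rfl⟩ := hmap B hB
    rw [edgeCount_map f hf, edgeCount_map f hf]
    exact h A B (Set.subset_univ _) (Set.subset_univ _) ((hinit B).1 hBi) (by simpa using hAB)

/-- Initial segments of a total order form a chain, so their sizes decide inclusion. -/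
theorem IsInitialIn.subset_of_card_le {lt : α → α → Prop} [IsStrictTotalOrder α lt] {W : Set α}
    {B C : Finset α} (hB : IsInitialIn lt W B) (hC : IsInitialIn lt W C) (hBW : ↑B ⊆ W)
    (hCW : ↑C ⊆ W) (h : B.card ≤ C.card) : B ⊆ C := by
  intro x hx
  by_contra hxC
  have hCB : C ⊆ B := by
    intro y hy
    rcases trichotomous_of lt x y with hxy | rfl | hxy
    · exact absurd (hC x (hBW hx) y hy hxy) hxC
    · exact hx
    · exact hB y (hCW hy) x hx hxy
  exact hxC (Finset.eq_of_subset_of_card_le hCB h ▸ hx)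

theorem exists_isInitialIn_card_eq [Fintype α] (lt : α → α → Prop) [IsStrictTotalOrder α lt]
    (W : Set α) (A : Finset α) (hA : ↑A ⊆ W) :
    ∃ B : Finset α, ↑B ⊆ W ∧ IsInitialIn lt W B ∧ B.card = A.card := by
  classical
  let _ := linearOrderOfSTO lt
  have key : ∀ k ≤ A.card, ∃ B : Finset α, ↑B ⊆ W ∧ IsInitialIn lt W B ∧ B.card = k := by
    intro k
    induction k with
    | zero => exact fun _ => ⟨∅, by simp, by simp [IsInitialIn], rfl⟩
    | succ k ih =>
      intro hk
      obtain ⟨B, hBW, hB, hc⟩ := ih (by omega)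
      have hne : (Finset.univ.filter fun x => x ∈ W ∧ x ∉ B).Nonempty := by
        obtain ⟨x, hx, hxB⟩ := Finset.exists_mem_notMem_of_card_lt_card (s := B) (t := A) (by omega)
        exact ⟨x, by simpa using ⟨hA hx, hxB⟩⟩
      obtain ⟨m, hm, hmin⟩ := Finset.exists_min_image _ id hne
      simp only [Finset.mem_filter, Finset.mem_univ, true_and, id, and_imp] at hm hmin
      refine ⟨insert m B, ?_, ?_, by rw [Finset.card_insert_of_notMem hm.2, hc]⟩
      · rw [Finset.coe_insert]
        exact Set.insert_subset hm.1 hBW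
      · intro x hx y hy hxy
        rw [Finset.mem_insert] at hy ⊢
        by_cases hxB : x ∈ B
        · exact Or.inr hxB
        · rcases hy with rfl | hy
          · exact absurd hxy (not_lt_of_ge (hmin x hx hxB))
          · exact Or.inr (hB x hx y hy hxy)
  exact key _ le_rfl

/-- A family of finite sets has a member that maximizes `f` and cannot be improved without
loss in `f` by exchanging elements for smaller ones. -/
theorem exists_maximal_of_exchange [Fintype α] (lt : α → α → Prop) [IsStrictTotalOrder α lt]
    (F : Finset (Finset α)) (hF : F.Nonempty) (f : Finset α → ℕ) :
    ∃ A ∈ F, (∀ B ∈ F, f B ≤ f A) ∧ ∀ B ∈ F, f A ≤ f B →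
      (∀ x ∈ B, x ∉ A → ∃ y ∈ A, y ∉ B ∧ lt x y) → B = A := by
  classical
  let _ := linearOrderOfSTO lt
  obtain ⟨M, hM, hmax⟩ := Finset.exists_max_image F f hF
  -- The tie among maximizers is broken by the colexicographic order; the exchange condition says
  -- precisely that `B` is colexicographically at most `A`.
  obtain ⟨A, hA, hmin⟩ := Finset.exists_min_image (F.filter fun A => f A = f M) toColex
    ⟨M, by simpa using hM⟩
  rw [Finset.mem_filter] at hA
  refine ⟨A, hA.1, fun B hB => hA.2 ▸ hmax B hB, fun B hB hAB hex => ?_⟩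
  have h1 := hmin B (Finset.mem_filter.2 ⟨hB, le_antisymm (hmax B hB) (hA.2 ▸ hAB)⟩)
  have h2 : toColex B ≤ toColex A := by
    rw [Finset.Colex.toColex_le_toColex]
    intro x hx hxA
    obtain ⟨y, hy, hyB, hxy⟩ := hex x hx hxA
    exact ⟨y, hy, hyB, le_of_lt hxy⟩
  exact toColex_inj.1 (le_antisymm h2 h1)

end Initial

/-! ### Slices of the product and compression -/

section Slice

variable {ι : Type} {V : ι → Type u}

/-- The tuples that agree with `p` outside of `S`. -/
def slice (S : Finset ι) (p : ∀ i, V i) : Set (∀ i, V i) :=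
  {x | ∀ i, i ∉ S → x i = p i}

theorem mem_slice {S : Finset ι} {p x : ∀ i, V i} : x ∈ slice S p ↔ ∀ i, i ∉ S → x i = p i :=
  Iff.rfl

variable [LinearOrder ι]

theorem mem_slice_erase {S : Finset ι} {i : ι} (hi : i ∈ S) {p x : ∀ i, V i} {v : V i} :
    x ∈ slice (S.erase i) (Function.update p i v) ↔ x ∈ slice S p ∧ x i = v := by
  simp only [mem_slice, Finset.mem_erase, not_and_or, not_not]
  constructor
  · intro h
    refine ⟨fun j hj => ?_, by simpa using h i (Or.inl rfl)⟩
    have hji : j ≠ i := by rintro rfl; exact hj hi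
    simpa [hji] using h j (Or.inr hj)
  · rintro ⟨h, rfl⟩ j hj
    rcases eq_or_ne j i with rfl | hji
    · simp
    · simpa [hji] using h j (hj.resolve_left hji)

variable (G : ∀ i, SimpleGraph (V i))

theorem cartesianProduct_adj_of_ne {i : ι} {x y : ∀ i, V i} (h : x i ≠ y i) :
    (cartesianProduct G).Adj x y ↔ (G i).Adj (x i) (y i) ∧ y = Function.update x i (y i) := by
  constructor
  · rintro ⟨k, hk, hk'⟩
    have hik : i = k := by
      by_contra hik
      exact h (hk' i hik)
    subst hik
    refine ⟨hk, ?_⟩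
    ext j
    rcases eq_or_ne j i with rfl | hj
    · simp
    · simp [hj, hk' j hj]
  · rintro ⟨hi, hy⟩
    refine ⟨i, hi, fun j hj => ?_⟩
    rw [hy]
    simp [hj]

variable {G}

/-- The only possible neighbour of `x` in another section is `x` with its coordinate `i` changed, so
the edges between two sections form a matching. -/
theorem edgeCount_sections_le {i : ι} {v w : V i} (hvw : v ≠ w) {A B : Finset (∀ i, V i)}
    (hA : ∀ x ∈ A, x i = v) (hB : ∀ x ∈ B, x i = w) :
    edgeCount (cartesianProduct G) A B ≤ A.card := by
  classical
  unfold edgeCount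
  rw [Finset.card_eq_sum_ones]
  refine Finset.sum_le_sum fun x hx => ?_
  rw [← Finset.card_filter]
  refine Finset.card_le_one.2 fun y hy z hz => ?_
  rw [Finset.mem_filter] at hy hz
  have key : ∀ y ∈ B, (cartesianProduct G).Adj x y → y = Function.update x i w := by
    intro y hy hxy
    have := ((cartesianProduct_adj_of_ne G (by rwa [hA x hx, hB y hy])).1 hxy).2
    rwa [hB y hy] at this
  rw [key y hy.1 hy.2, key z hz.1 hz.2]

theorem edgeCount_sections_eq_zero {i : ι} {v w : V i} (hvw : v ≠ w) (hG : ¬ (G i).Adj v w)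
    {A B : Finset (∀ i, V i)} (hA : ∀ x ∈ A, x i = v) (hB : ∀ x ∈ B, x i = w) :
    edgeCount (cartesianProduct G) A B = 0 := by
  unfold edgeCount
  refine Finset.sum_eq_zero fun x hx => Finset.sum_eq_zero fun y hy => if_neg fun hxy => ?_
  have := ((cartesianProduct_adj_of_ne G (by rwa [hA x hx, hB y hy])).1 hxy).1
  rw [hA x hx, hB y hy] at this
  exact hG this

variable [∀ i, LinearOrder (V i)]

/-- The lexicographic order on tuples. -/
def tupleLexLT (x y : ∀ i, V i) : Prop :=
  ∃ i, (∀ j, j < i → x j = y j) ∧ x i < y i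

instance [Finite ι] : IsStrictTotalOrder (∀ i, V i) tupleLexLT where
  trichotomous x y hxy hyx := by
    rcases lt_trichotomy (toLex x) (toLex y) with h | h | h
    · exact absurd h hxy
    · exact toLex_inj.1 h
    · exact absurd h hyx
  irrefl x h := lt_irrefl (toLex x) h
  trans x y z h h' := lt_trans (a := toLex x) (b := toLex y) (c := toLex z) h h'

theorem tupleLexLT_update {i : ι} {x y : ∀ i, V i} (h : x i = y i) (v : V i) :
    tupleLexLT (Function.update x i v) (Function.update y i v) ↔ tupleLexLT x y := by
  unfold tupleLexLT
  refine exists_congr fun k => and_congr (forall₂_congr fun j _ => ?_) ?_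
  · rcases eq_or_ne j i with rfl | hj
    · simp [h]
    · simp [hj]
  · rcases eq_or_ne k i with rfl | hk
    · simp [h]
    · simp [hk]

/-- Moving `B` to the section at `w` preserves the order, so its image is an initial segment there
and, being no larger than `C`, lies inside `C`. The matching between the sections therefore covers
all of `B`, which attains the bound of `edgeCount_sections_le`. -/
theorem card_le_edgeCount_sections [Finite ι] {S : Finset ι} {i : ι} (hi : i ∈ S)
    {p : ∀ i, V i} {v w : V i} (hvw : (G i).Adj v w) {B C : Finset (∀ i, V i)}
    (hB : IsInitialIn tupleLexLT (slice (S.erase i) (Function.update p i v)) B)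
    (hC : IsInitialIn tupleLexLT (slice (S.erase i) (Function.update p i w)) C)
    (hBv : ↑B ⊆ slice (S.erase i) (Function.update p i v))
    (hCw : ↑C ⊆ slice (S.erase i) (Function.update p i w)) (h : B.card ≤ C.card) :
    B.card ≤ edgeCount (cartesianProduct G) B C := by
  classical
  have hmem : ∀ {v w : V i} {x : ∀ i, V i}, x ∈ slice (S.erase i) (Function.update p i v) →
      Function.update x i w ∈ slice (S.erase i) (Function.update p i w) := by
    intro v w x hx
    rw [mem_slice_erase hi, mem_slice] at hx ⊢
    refine ⟨fun j hj => ?_, by simp⟩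
    have hji : j ≠ i := by rintro rfl; exact hj hi
    simpa [hji] using hx.1 j hj
  have hBi : ∀ x ∈ B, x i = v := fun x hx => ((mem_slice_erase hi).1 (hBv hx)).2
  have hinj : Set.InjOn (fun x : ∀ i, V i => Function.update x i w) B := by
    intro x hx y hy hxy
    have := congrArg (fun z => Function.update z i v) hxy
    simp only [Function.update_idem] at this
    rwa [← hBi x hx, Function.update_eq_self, hBi x hx, ← hBi y hy,
      Function.update_eq_self] at this
  have hsub : B.image (fun x => Function.update x i w) ⊆ C := by
    refine IsInitialIn.subset_of_card_le (lt := tupleLexLT)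
      (W := slice (S.erase i) (Function.update p i w)) ?_ hC ?_ hCw
      (Finset.card_image_le.trans h)
    · intro x hx y hy hxy
      obtain ⟨z, hz, rfl⟩ := Finset.mem_image.1 hy
      have hxw := ((mem_slice_erase hi).1 hx).2
      refine Finset.mem_image.2 ⟨Function.update x i v, hB _ (hmem hx) z hz ?_, ?_⟩
      · rw [← tupleLexLT_update (v := v) (by simpa using hxw), Function.update_idem,
          ← hBi z hz, Function.update_eq_self] at hxy
        rwa [hBi z hz] at hxy
      · rw [Function.update_idem, ← hxw, Function.update_eq_self]
    · intro x hx
      obtain ⟨z, hz, rfl⟩ := Finset.mem_image.1 hx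
      exact hmem (hBv hz)
  unfold edgeCount
  rw [Finset.card_eq_sum_ones]
  refine Finset.sum_le_sum fun x hx => ?_
  have hadj : (cartesianProduct G).Adj x (Function.update x i w) := by
    rw [cartesianProduct_adj_of_ne (i := i)]
    · simpa [hBi x hx] using hvw
    · simpa [hBi x hx] using hvw.ne
  refine le_trans (le_of_eq ?_) (Finset.single_le_sum (fun _ _ => Nat.zero_le _)
    (hsub (Finset.mem_image_of_mem _ hx)))
  rw [if_pos hadj]

/-- Edges inside a section do not decrease because `hopt` makes initial segments optimal there.
Between two adjacent sections, the smaller size bounds the edges of `A`, and initial segments reach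
this bound. -/
theorem exists_compression [Fintype ι] [∀ i, Fintype (V i)] {S : Finset ι} {i : ι} (hi : i ∈ S)
    {p : ∀ i, V i}
    (hopt : ∀ v, IsOptimalOn (cartesianProduct G) tupleLexLT
      (slice (S.erase i) (Function.update p i v)))
    {A : Finset (∀ i, V i)} (hA : ↑A ⊆ slice S p) :
    ∃ C : Finset (∀ i, V i), ↑C ⊆ slice S p ∧
      edgeCount (cartesianProduct G) A A ≤ edgeCount (cartesianProduct G) C C ∧
      ∀ v, (C.filter fun x => x i = v).card = (A.filter fun x => x i = v).card ∧
        IsInitialIn tupleLexLT (slice (S.erase i) (Function.update p i v))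
          (C.filter fun x => x i = v) := by
  classical
  have hAv : ∀ v, ↑(A.filter fun x => x i = v) ⊆ slice (S.erase i) (Function.update p i v) := by
    intro v x hx
    rw [Finset.mem_coe, Finset.mem_filter] at hx
    exact (mem_slice_erase hi).2 ⟨hA hx.1, hx.2⟩
  choose C hCW hCi hCc using fun v => exists_isInitialIn_card_eq tupleLexLT _ _ (hAv v)
  have hC : ∀ v, ((Finset.univ.filter fun x => x ∈ C (x i)).filter fun x => x i = v) = C v := by
    intro v
    ext x
    simp only [Finset.mem_filter, Finset.mem_univ, true_and]
    constructor
    · rintro ⟨h, rfl⟩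
      exact h
    · intro h
      obtain rfl := ((mem_slice_erase hi).1 (hCW v h)).2
      exact ⟨h, rfl⟩
  refine ⟨Finset.univ.filter fun x => x ∈ C (x i), ?_, ?_, fun v => ?_⟩
  · intro x hx
    simp only [Finset.coe_filter, Finset.mem_univ, true_and] at hx
    exact ((mem_slice_erase hi).1 (hCW _ hx)).1
  · rw [edgeCount_fiberwise _ (fun x => x i), edgeCount_fiberwise _ (fun x => x i)]
    refine Finset.sum_le_sum fun v _ => Finset.sum_le_sum fun w _ => ?_
    rw [hC, hC]
    have hAi : ∀ v, ∀ x ∈ A.filter fun x => x i = v, x i = v := fun v x hx =>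
      (Finset.mem_filter.1 hx).2
    rcases eq_or_ne v w with rfl | hvw
    · exact hopt v _ _ (hAv v) (hCW v) (hCi v) (hCc v).symm
    · by_cases hadj : (G i).Adj v w
      · rcases le_total (C v).card (C w).card with h | h
        · refine (edgeCount_sections_le hvw (hAi v) (hAi w)).trans ?_
          rw [← hCc v]
          exact card_le_edgeCount_sections hi hadj (hCi v) (hCi w) (hCW v) (hCW w) h
        · rw [edgeCount_comm, edgeCount_comm _ (C v)]
          refine (edgeCount_sections_le hvw.symm (hAi w) (hAi v)).trans ?_
          rw [← hCc w]
          exact card_le_edgeCount_sections hi hadj.symm (hCi w) (hCi v) (hCW w) (hCW v) h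
      · rw [edgeCount_sections_eq_zero hvw hadj (hAi v) (hAi w)]
        exact Nat.zero_le _
  · rw [hC]
    exact ⟨hCc v, hCi v⟩

/-- A maximizer that admits no improving exchange is compressed in every direction. -/
theorem isInitialIn_section_of_no_exchange [Fintype ι] [∀ i, Fintype (V i)] {S : Finset ι} {i : ι}
    (hi : i ∈ S) {p : ∀ i, V i}
    (hopt : ∀ v, IsOptimalOn (cartesianProduct G) tupleLexLT
      (slice (S.erase i) (Function.update p i v)))
    {A : Finset (∀ i, V i)} (hA : ↑A ⊆ slice S p)
    (hex : ∀ B : Finset (∀ i, V i), ↑B ⊆ slice S p → B.card = A.card →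
      edgeCount (cartesianProduct G) A A ≤ edgeCount (cartesianProduct G) B B →
      (∀ x ∈ B, x ∉ A → ∃ y ∈ A, y ∉ B ∧ tupleLexLT x y) → B = A)
    {x y : ∀ i, V i} (hx : x ∈ slice S p) (hy : y ∈ A) (hxy : tupleLexLT x y) (hi' : x i = y i) :
    x ∈ A := by
  classical
  obtain ⟨C, hCW, hAC, hC⟩ := exists_compression hi hopt hA
  have hCA : C = A := by
    refine hex C hCW ?_ hAC ?_
    · rw [Finset.card_eq_sum_card_fiberwise (f := fun x => x i) (t := Finset.univ) (by simp),
        Finset.card_eq_sum_card_fiberwise (s := A) (f := fun x => x i) (t := Finset.univ) (by simp)]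
      exact Finset.sum_congr rfl fun v _ => (hC v).1
    · intro z hz hzA
      -- The two sections through `z` have equal size, so the old one contains some `w` that the new
      -- one lost. The new section is initial and contains `z`, so `w` comes after `z`: compression
      -- only moves elements down.
      have hne : ¬ (A.filter fun x => x i = z i) ⊆ C.filter fun x => x i = z i := by
        intro hsub
        have := Finset.eq_of_subset_of_card_le hsub (hC _).1.le
        have hz' : z ∈ A.filter fun x => x i = z i := this ▸ Finset.mem_filter.2 ⟨hz, rfl⟩
        exact hzA (Finset.mem_filter.1 hz').1
      obtain ⟨w, hw, hwC⟩ := Finset.not_subset.1 hne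
      have hw' := Finset.mem_filter.1 hw
      refine ⟨w, hw'.1, fun h => hwC (Finset.mem_filter.2 ⟨h, hw'.2⟩), ?_⟩
      rcases trichotomous_of tupleLexLT z w with h | rfl | h
      · exact h
      · exact absurd hw'.1 hzA
      · exact absurd ((hC (z i)).2 w ((mem_slice_erase hi).2 ⟨hA hw'.1, hw'.2⟩) z
          (Finset.mem_filter.2 ⟨hz, rfl⟩) h) hwC
  subst hCA
  exact (Finset.mem_filter.1 ((hC (y i)).2 x ((mem_slice_erase hi).2 ⟨hx, hi'⟩) y
    (Finset.mem_filter.2 ⟨hy, rfl⟩) hxy)).1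

end Slice

/-! ### The gap of a compressed set, the exchange, and the induction -/

section Exchange

variable {ι : Type} [LinearOrder ι] {V : ι → Type u} [∀ i, LinearOrder (V i)]

theorem tupleLexLT_of_min_lt {S : Finset ι} {p : ∀ i, V i} {m : ι} (hm : ∀ i ∈ S, m ≤ i)
    {x y : ∀ i, V i} (hx : x ∈ slice S p) (hy : y ∈ slice S p) (h : x m < y m) :
    tupleLexLT x y := by
  refine ⟨m, fun j hj => ?_, h⟩
  have hjS : j ∉ S := fun hjS => absurd (hm j hjS) (not_le_of_gt hj)
  rw [hx j hjS, hy j hjS]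

theorem tupleLexLT_pair_iff {m l : ι} (hml : m < l) {q x y : ∀ i, V i} (hx : x ∈ slice {m, l} q)
    (hy : y ∈ slice {m, l} q) :
    tupleLexLT x y ↔ x m < y m ∨ (x m = y m ∧ x l < y l) := by
  have hxy : ∀ j, j ≠ m → j ≠ l → x j = y j := fun j h h' => by
    rw [hx j (by simp [h, h']), hy j (by simp [h, h'])]
  constructor
  · rintro ⟨i, hi, hlt⟩
    by_cases him : i = m
    · subst him
      exact Or.inl hlt
    · by_cases hil : i = l
      · subst hil
        exact Or.inr ⟨hi m hml, hlt⟩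
      · exact absurd (hxy i him hil) hlt.ne
  · rintro (h | ⟨h, h'⟩)
    · refine ⟨m, fun j hj => hxy j hj.ne (hj.trans hml).ne, h⟩
    · refine ⟨l, fun j hj => ?_, h'⟩
      by_cases hjm : j = m
      · subst hjm
        exact h
      · exact hxy j hjm hj.ne

/-- The shape of the first missing and the last present tuple of a compressed set. -/
theorem compressed_gap [Finite ι] [∀ i, Finite (V i)] {S : Finset ι} {p : ∀ i, V i} {m k l : ι}
    (hmS : m ∈ S) (hkS : k ∈ S) (hlS : l ∈ S) (hmin : ∀ i ∈ S, m ≤ i) (hmax : ∀ i ∈ S, i ≤ l)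
    (hmk : m < k) (hkl : k < l) {A : Finset (∀ i, V i)}
    (hcomp : ∀ i ∈ S, ∀ x ∈ slice S p, ∀ y ∈ A, tupleLexLT x y → x i = y i → x ∈ A)
    {a b : ∀ i, V i} (ha : a ∈ slice S p) (hb : b ∈ slice S p) (haA : a ∉ A) (hbA : b ∈ A)
    (hab : tupleLexLT a b) :
    a m < b m ∧ (∀ c, a m < c → b m ≤ c) ∧ b l < a l ∧
      ∀ j ∈ S, j ≠ m → j ≠ l → ∀ z, z ≤ a j ∧ b j ≤ z := by
  have hml : m < l := hmk.trans hkl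
  have hm : a m < b m := by
    obtain ⟨i, hi, hlt⟩ := hab
    have hiS : i ∈ S := by
      by_contra hiS
      rw [ha i hiS, hb i hiS] at hlt
      exact lt_irrefl _ hlt
    rcases (hmin i hiS).eq_or_lt with rfl | h
    · exact hlt
    · exact absurd (hcomp m hmS a ha b hbA ⟨i, hi, hlt⟩ (hi m h)) haA
  refine ⟨hm, fun c hc => ?_, ?_, fun j hjS hjm hjl z => ⟨?_, ?_⟩⟩
  · by_contra! hcb
    have hz : ∀ i, ∃ t : V i, ∀ s, t ≤ s := fun i => by
      have : Nonempty (V i) := ⟨p i⟩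
      exact Finite.exists_min id
    choose z hz using hz
    set w : ∀ i, V i := fun i =>
      if i ∈ S then Function.update (Function.update z l (a l)) m c i else p i with hw
    set u : ∀ i, V i := fun i => if i ∈ S then Function.update z m (b m) i else p i with hu
    have hwS : w ∈ slice S p := fun i hi => by simp [hw, hi]
    have huS : u ∈ slice S p := fun i hi => by simp [hu, hi]
    have hwm : w m = c := by simp [hw, hmS]
    have hum : u m = b m := by simp [hu, hmS]
    have hwl : w l = a l := by simp [hw, hlS, hml.ne']
    have hwk : w k = u k := by simp [hw, hu, hkS, hmk.ne', hkl.ne]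
    have huA : u ∈ A := by
      rcases trichotomous_of tupleLexLT u b with h | h | ⟨i, _, hlt⟩
      · exact hcomp m hmS u huS b hbA h hum
      · rwa [h]
      · by_cases hiS : i ∈ S
        · by_cases him : i = m
          · subst him
            exact absurd hlt (by simp [hum])
          · refine absurd hlt (not_lt_of_ge ?_)
            simpa [hu, hiS, him] using hz i (b i)
        · rw [hb i hiS, huS i hiS] at hlt
          exact absurd hlt (lt_irrefl _)
    have hwA : w ∈ A := hcomp k hkS w hwS u huA
      (tupleLexLT_of_min_lt hmin hwS huS (by rwa [hwm, hum])) hwk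
    exact haA (hcomp l hlS a ha w hwA (tupleLexLT_of_min_lt hmin ha hwS (by rwa [hwm])) hwl.symm)
  · by_contra! hle
    rcases hle.eq_or_lt with h | h
    · exact haA (hcomp l hlS a ha b hbA hab h)
    · set w := Function.update a l (b l) with hw
      have hwm : w m = a m := by simp [hw, hml.ne]
      have hwl : w l = b l := by simp [hw]
      have hwS : w ∈ slice S p := fun i hi => by
        have : i ≠ l := by rintro rfl; exact hi hlS
        simpa [hw, this] using ha i hi
      have haw : tupleLexLT a w :=
        ⟨l, fun j hj => by simp [hw, hj.ne], by rwa [hwl]⟩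
      have hwA : w ∈ A := hcomp l hlS w hwS b hbA
        (tupleLexLT_of_min_lt hmin hwS hb (by rwa [hwm])) hwl
      exact haA (hcomp m hmS a ha w hwA haw hwm.symm)
  · by_contra! hlt
    have hmj : m < j := lt_of_le_of_ne (hmin j hjS) (Ne.symm hjm)
    have hjl' : j < l := lt_of_le_of_ne (hmax j hjS) hjl
    -- A tuple after `a` that shares `m` with `a` and `l` with `b`: compression in `l` puts it in
    -- `A`, then compression in `m` puts `a` there.
    set w : ∀ i, V i := fun i => if i < j then a i else Function.update b j z i with hw
    have hwm : w m = a m := by simp [hw, hmj]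
    have hwl : w l = b l := by simp [hw, hjl'.not_gt, hjl'.ne']
    have hwS : w ∈ slice S p := fun i hi => by
      have : i ≠ j := by rintro rfl; exact hi hjS
      simp [hw, this, ha i hi, hb i hi]
    have haw : tupleLexLT a w := ⟨j, fun i hi => by simp [hw, hi], by simpa [hw] using hlt⟩
    have hwA : w ∈ A := hcomp l hlS w hwS b hbA
      (tupleLexLT_of_min_lt hmin hwS hb (by rwa [hwm])) hwl
    exact haA (hcomp m hmS a ha w hwA haw hwm.symm)
  · by_contra! hlt
    have hmj : m < j := lt_of_le_of_ne (hmin j hjS) (Ne.symm hjm)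
    have hjl' : j < l := lt_of_le_of_ne (hmax j hjS) hjl
    -- The mirror image: before `b`, sharing `m` with `b` and `l` with `a`.
    set w : ∀ i, V i := fun i => if i < j then b i else Function.update a j z i with hw
    have hwm : w m = b m := by simp [hw, hmj]
    have hwl : w l = a l := by simp [hw, hjl'.not_gt, hjl'.ne']
    have hwS : w ∈ slice S p := fun i hi => by
      have : i ≠ j := by rintro rfl; exact hi hjS
      simp [hw, this, ha i hi, hb i hi]
    have hwb : tupleLexLT w b := ⟨j, fun i hi => by simp [hw, hi], by simpa [hw] using hlt⟩
    have hwA : w ∈ A := hcomp m hmS w hwS b hbA hwb hwm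
    exact haA (hcomp l hlS a ha w hwA (tupleLexLT_of_min_lt hmin ha hwS (by rwa [hwm])) hwl.symm)

/-- In a two-dimensional slice, the set with the gap and the initial segment of its size. -/
theorem exists_pair_exchange [Fintype ι] [∀ i, Fintype (V i)] {m l : ι} (hml : m < l)
    {a b : ∀ i, V i} (hm : a m < b m) (hsucc : ∀ c, a m < c → b m ≤ c) (hl : b l < a l) :
    ∃ A B : Finset (∀ i, V i),
      (∀ x, x ∈ A ↔ x ∈ slice {m, l} b ∧
        (x m < a m ∨ (x m = a m ∧ x l < a l) ∨ (x m = b m ∧ x l ≤ b l))) ∧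
      ↑B ⊆ slice {m, l} b ∧ IsInitialIn tupleLexLT (slice {m, l} b) B ∧ B.card = A.card ∧
      (∀ x ∈ B, x ∉ A → x ∈ slice {m, l} b ∧ x m = a m ∧ a l ≤ x l) ∧
      (∀ y ∈ A, y ∉ B → y ∈ slice {m, l} b ∧ y m = b m ∧ y l ≤ b l) ∧ (A \ B).Nonempty := by
  classical
  set T : Set (∀ i, V i) := slice {m, l} b with hT
  have hlt : ∀ {x y}, x ∈ T → y ∈ T → (tupleLexLT x y ↔ x m < y m ∨ (x m = y m ∧ x l < y l)) :=
    fun hx hy => tupleLexLT_pair_iff hml hx hy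
  have hfilter : ∀ P : (∀ i, V i) → Prop, ∃ A : Finset (∀ i, V i), ∀ x, x ∈ A ↔ P x :=
    fun P => ⟨Finset.univ.filter P, by simp⟩
  obtain ⟨A, hA⟩ : ∃ A : Finset (∀ i, V i), ∀ x, x ∈ A ↔ x ∈ T ∧
      (x m < a m ∨ (x m = a m ∧ x l < a l) ∨ (x m = b m ∧ x l ≤ b l)) :=
    hfilter _
  obtain ⟨B, hBT, hBi, hcard⟩ := exists_isInitialIn_card_eq tupleLexLT T A
    fun x hx => ((hA x).1 hx).1
  -- `B` is squeezed between the initial segments `A₀` and `A₁`, which stop just before the pair `(a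
  -- m, a l)` and at `b`. This confines both differences of `A` and `B` to the two columns at `a m`
  -- and `b m`.
  obtain ⟨A₀, hA₀⟩ : ∃ A₀ : Finset (∀ i, V i), ∀ x, x ∈ A₀ ↔ x ∈ T ∧
      (x m < a m ∨ (x m = a m ∧ x l < a l)) :=
    hfilter _
  obtain ⟨A₁, hA₁⟩ : ∃ A₁ : Finset (∀ i, V i), ∀ x, x ∈ A₁ ↔ x ∈ T ∧
      (x m < b m ∨ (x m = b m ∧ x l ≤ b l)) :=
    hfilter _
  have hA₀B : A₀ ⊆ B := by
    refine IsInitialIn.subset_of_card_le (lt := tupleLexLT) (W := T) (fun y hy z hz hyz => ?_) hBi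
      (fun y hy => ((hA₀ y).1 hy).1) hBT (hcard ▸ Finset.card_le_card fun y hy => ?_)
    · rw [hA₀] at hz ⊢
      rw [hlt hy hz.1] at hyz
      exact ⟨hy, by grind only⟩
    · rw [hA₀] at hy
      exact (hA y).2 ⟨hy.1, hy.2.imp_right Or.inl⟩
  have hBA₁ : B ⊆ A₁ := by
    refine hBi.subset_of_card_le (W := T) (fun y hy z hz hyz => ?_) hBT
      (fun y hy => ((hA₁ y).1 hy).1) (hcard ▸ Finset.card_le_card fun y hy => ?_)
    · rw [hA₁] at hz ⊢
      rw [hlt hy hz.1] at hyz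
      exact ⟨hy, by grind only⟩
    · rw [hA] at hy
      exact (hA₁ y).2 ⟨hy.1, by grind only⟩
  refine ⟨A, B, hA, hBT, hBi, hcard, fun x hx hxA => ?_, fun y hy hyB => ?_, ?_⟩
  · have h1 := (hA₁ x).1 (hBA₁ hx)
    rw [hA] at hxA
    have h2 := hsucc (x m)
    exact ⟨h1.1, by grind only⟩
  · have h1 := (hA y).1 hy
    have h2 : ¬ (y m < a m ∨ (y m = a m ∧ y l < a l)) := fun h => hyB (hA₀B ((hA₀ y).2 ⟨h1.1, h⟩))
    exact ⟨h1.1, by grind only⟩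
  · rw [Finset.nonempty_iff_ne_empty]
    -- Otherwise `A` would be an initial segment containing `b`, hence would contain the earlier
    -- tuple `q`, which is the gap.
    intro hYe
    have hAB : A = B :=
      Finset.eq_of_subset_of_card_le (Finset.sdiff_eq_empty_iff_subset.1 hYe) hcard.le
    set q : ∀ i, V i := fun i => if i = m ∨ i = l then a i else b i with hq
    have hqm : q m = a m := by simp [hq]
    have hql : q l = a l := by simp [hq]
    have hbT : b ∈ T := fun _ _ => rfl
    have hqT : q ∈ T := fun j hj => by
      simp only [Finset.mem_insert, Finset.mem_singleton] at hj
      simp [hq, hj]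
    have hbB : b ∈ B := hAB ▸ (hA b).2 ⟨hbT, Or.inr (Or.inr ⟨rfl, le_rfl⟩)⟩
    have hqB : q ∈ B := hBi q hqT b hbB ((hlt hqT hbT).2 (Or.inl (by rwa [hqm])))
    rw [← hAB, hA, hqm, hql] at hqB
    have h1 := hqB.2
    grind only

variable {G : ∀ i, SimpleGraph (V i)}

/-- A compressed set with a gap is improved by filling the gap from the end of the set. -/
theorem exists_exchange [Fintype ι] [∀ i, Fintype (V i)] {S : Finset ι} {p : ∀ i, V i} {m l : ι}
    (hmS : m ∈ S) (hlS : l ∈ S) (hmin : ∀ i ∈ S, m ≤ i) (hmax : ∀ i ∈ S, i ≤ l) (hml : m < l)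
    (hopt : ∀ q, IsOptimalOn (cartesianProduct G) tupleLexLT (slice {m, l} q))
    {A : Finset (∀ i, V i)} (hA : ↑A ⊆ slice S p)
    (hcomp : ∀ i ∈ S, ∀ x ∈ slice S p, ∀ y ∈ A, tupleLexLT x y → x i = y i → x ∈ A)
    {a b : ∀ i, V i} (ha : a ∈ slice S p) (haA : a ∉ A) (hbA : b ∈ A)
    (hafirst : ∀ x ∈ slice S p, tupleLexLT x a → x ∈ A) (hblast : ∀ x ∈ A, ¬ tupleLexLT b x)
    (hm : a m < b m) (hsucc : ∀ c, a m < c → b m ≤ c) (hl : b l < a l)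
    (hmid : ∀ j ∈ S, j ≠ m → j ≠ l → ∀ z, z ≤ a j ∧ b j ≤ z) :
    ∃ B : Finset (∀ i, V i), ↑B ⊆ slice S p ∧ B.card = A.card ∧
      edgeCount (cartesianProduct G) A A ≤ edgeCount (cartesianProduct G) B B ∧
      (∀ x ∈ B, x ∉ A → ∃ y ∈ A, y ∉ B ∧ tupleLexLT x y) ∧ B ≠ A := by
  classical
  have hb : b ∈ slice S p := hA hbA
  set T : Set (∀ i, V i) := slice {m, l} b with hT
  have hTmid : ∀ x ∈ T, ∀ j, j ≠ m → j ≠ l → x j = b j := fun x hx j h h' =>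
    hx j (by simp [h, h'])
  have hTmem : ∀ x : ∀ i, V i, (∀ j, j ≠ m → j ≠ l → x j = b j) → x ∈ T := by
    intro x hx j hj
    simp only [Finset.mem_insert, Finset.mem_singleton, not_or] at hj
    exact hx j hj.1 hj.2
  have hTS : ∀ x ∈ T, x ∈ slice S p := by
    intro x hx j hj
    rw [hTmid x hx j (by rintro rfl; exact hj hmS) (by rintro rfl; exact hj hlS), hb j hj]
  have hbT : b ∈ T := hTmem b fun _ _ _ => rfl
  have hlt : ∀ {x y}, x ∈ T → y ∈ T → (tupleLexLT x y ↔ x m < y m ∨ (x m = y m ∧ x l < y l)) :=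
    fun hx hy => tupleLexLT_pair_iff hml hx hy
  -- `σ` carries the two-dimensional slice through `b` to the parallel one through `a`. The model
  -- set `A'` combines both: its column at `b m` stands for the end of `A` near `b`, while its
  -- column at `a m` is cut at `a l`, as `A` is in the slice through `a`. Elements are removed near
  -- `b` (`Y`) and inserted near `a` (`X`).
  set σ : (∀ i, V i) → ∀ i, V i := fun x i => if i = m ∨ i = l then x i else a i with hσ
  have hσm : ∀ x, σ x m = x m := fun x => by simp [hσ]
  have hσl : ∀ x, σ x l = x l := fun x => by simp [hσ]
  have hσmid : ∀ x j, j ≠ m → j ≠ l → σ x j = a j := fun x j h h' => by simp [hσ, h, h']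
  have hσS : ∀ x, σ x ∈ slice S p := by
    intro x j hj
    rw [hσmid x j (by rintro rfl; exact hj hmS) (by rintro rfl; exact hj hlS), ha j hj]
  have hσinj : ∀ x ∈ T, ∀ y ∈ T, σ x = σ y → x = y := by
    intro x hx y hy h
    ext j
    by_cases hjm : j = m
    · subst hjm
      rw [← hσm x, h, hσm]
    · by_cases hjl : j = l
      · subst hjl
        rw [← hσl x, h, hσl]
      · rw [hTmid x hx j hjm hjl, hTmid y hy j hjm hjl]
  have hσadj : ∀ x ∈ T, ∀ y ∈ T, (cartesianProduct G).Adj x y →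
      (cartesianProduct G).Adj (σ x) (σ y) := by
    rintro x hx y hy ⟨i, hi, hi'⟩
    have hiT : i = m ∨ i = l := by
      by_contra! h
      rw [hTmid x hx i h.1 h.2, hTmid y hy i h.1 h.2] at hi
      exact hi.ne rfl
    refine ⟨i, by simpa [hσ, hiT] using hi, fun j hj => ?_⟩
    simp only [hσ]
    rw [hi' j hj]
  obtain ⟨A', B', hmemA', hB'T, hB'i, hcard, hXc, hYc, hYne⟩ :=
    exists_pair_exchange hml hm hsucc hl
  have hA'T : ↑A' ⊆ T := fun x hx => ((hmemA' x).1 hx).1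
  have hX : ∀ x ∈ B' \ A', x ∈ T ∧ x m = a m ∧ a l ≤ x l := fun x hx =>
    hXc x (Finset.mem_sdiff.1 hx).1 (Finset.mem_sdiff.1 hx).2
  have hY : ∀ y ∈ A' \ B', y ∈ T ∧ y m = b m ∧ y l ≤ b l := fun y hy =>
    hYc y (Finset.mem_sdiff.1 hy).1 (Finset.mem_sdiff.1 hy).2
  clear hXc hYc
  set X' := B' \ A' with hX'
  set Y := A' \ B' with hYdef
  set X := X'.image σ with hXdef
  have hXcard : X.card = Y.card := by
    rw [hXdef, Finset.card_image_of_injOn fun x hx y hy h =>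
      hσinj x (hX x hx).1 y (hX y hy).1 h]
    exact Finset.card_sdiff_comm hcard
  have hYA : Y ⊆ A := by
    intro y hy
    obtain ⟨hyT, hym, hyl⟩ := hY y hy
    rcases trichotomous_of tupleLexLT y b with h | h | h
    · exact hcomp m hmS y (hTS y hyT) b hbA h hym
    · rwa [h]
    · rw [hlt hbT hyT, hym] at h
      exact absurd (h.resolve_left (lt_irrefl _)).2 hyl.not_gt
  have hXmem : ∀ x ∈ X, x ∉ A ∧ x m = a m ∧ x ∈ slice S p := by
    intro x hx
    obtain ⟨z, hz, rfl⟩ := Finset.mem_image.1 hx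
    obtain ⟨-, hzm, hzl⟩ := hX z hz
    refine ⟨fun hzA => ?_, by rw [hσm, hzm], hσS z⟩
    have heq : ∀ j, j < l → a j = σ z j := by
      intro j hj
      by_cases hjm : j = m
      · subst hjm
        rw [hσm, hzm]
      · rw [hσmid z j hjm hj.ne]
    rcases hzl.eq_or_lt with h | h
    · have : σ z = a := by
        ext j
        by_cases hjl : j = l
        · subst hjl
          rw [hσl, h]
        · by_cases hjm : j = m
          · subst hjm
            rw [hσm, hzm]
          · rw [hσmid z j hjm hjl]
      exact haA (this ▸ hzA)
    · exact haA (hcomp m hmS a ha _ hzA ⟨l, heq, by rwa [hσl]⟩ (heq m hml))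
  have hXA : Disjoint X A := Finset.disjoint_left.2 fun x hx => (hXmem x hx).1
  have hCX : Disjoint (A \ Y) X := (hXA.mono_right Finset.sdiff_subset).symm
  -- Every neighbour in `A` of a removed tuple lies in the slice through `b`: a change in a middle
  -- coordinate would raise it from its minimum and lead past `b`. The cut of the column at `a m`
  -- loses no neighbour, because removed tuples have `l`-coordinate at most `b l < a l`.
  have e1 : edgeCount (cartesianProduct G) (A \ Y) Y ≤
      edgeCount (cartesianProduct G) (A' \ Y) Y := by
    refine edgeCount_le_edgeCount id id (fun _ _ _ _ h => h) (fun _ _ _ _ h => h) ?_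
    rintro c hc y hy ⟨i, hi, hi'⟩
    refine ⟨?_, hy, i, hi, hi'⟩
    obtain ⟨hcA, hcY⟩ := Finset.mem_sdiff.1 hc
    obtain ⟨hyT, hym, hyl⟩ := hY y hy
    refine Finset.mem_sdiff.2 ⟨(hmemA' c).2 ?_, hcY⟩
    by_cases him : i = m
    · subst him
      have hcT : c ∈ T := hTmem c fun j hj hj' => by rw [hi' j hj, hTmid y hyT j hj hj']
      have hcb := hblast c hcA
      rw [hlt hbT hcT] at hcb
      have hcl := hi' l hml.ne'
      refine ⟨hcT, ?_⟩
      rw [hcl]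
      rcases lt_trichotomy (c i) (b i) with h | h | h
      · rcases lt_trichotomy (c i) (a i) with h' | h' | h'
        · exact Or.inl h'
        · exact Or.inr (Or.inl ⟨h', hyl.trans_lt hl⟩)
        · exact absurd h (hsucc _ h').not_gt
      · exact Or.inr (Or.inr ⟨h, hyl⟩)
      · exact absurd (Or.inl h) hcb
    · have hcm := hi' m (Ne.symm him)
      by_cases hil : i = l
      · subst hil
        have hcT : c ∈ T := hTmem c fun j hj hj' => by rw [hi' j hj', hTmid y hyT j hj hj']
        have hcb := hblast c hcA
        rw [hlt hbT hcT] at hcb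
        refine ⟨hcT, Or.inr (Or.inr ⟨hcm.trans hym, le_of_not_gt fun h => ?_⟩)⟩
        exact hcb (Or.inr ⟨(hcm.trans hym).symm, h⟩)
      · exfalso
        have hyi := hTmid y hyT i him hil
        have hiS : i ∈ S := by
          by_contra hiS
          rw [hA hcA i hiS, hyi, hb i hiS] at hi
          exact hi.ne rfl
        have hbc : b i < c i :=
          lt_of_le_of_ne (hmid i hiS him hil (c i)).2 (by rw [← hyi]; exact hi.ne')
        refine hblast c hcA ⟨i, fun j hj => ?_, hbc⟩
        rw [hi' j hj.ne]
        by_cases hjm : j = m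
        · subst hjm
          exact hym.symm
        · rw [hTmid y hyT j hjm (hj.trans_le (hmax i hiS)).ne]
  -- A neighbour of `X'` cannot lie in the column at `b m`, where the `l`-coordinates are too small.
  -- Hence its image under `σ` precedes `a` and belongs to `A`.
  have e2 : edgeCount (cartesianProduct G) (A' \ Y) X' ≤
      edgeCount (cartesianProduct G) (A \ Y) X := by
    have hTC : ∀ c ∈ A' \ Y, c ∈ T := fun c hc => hA'T (Finset.mem_sdiff.1 hc).1
    refine edgeCount_le_edgeCount σ σ
      (fun x hx y hy h => hσinj x (hTC x hx) y (hTC y hy) h)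
      (fun x hx y hy h => hσinj x (hX x hx).1 y (hX y hy).1 h) ?_
    intro c hc x hx hcx
    have hcT := hTC c hc
    obtain ⟨hxT, hxm, hxl⟩ := hX x hx
    refine ⟨?_, Finset.mem_image_of_mem _ hx, hσadj c hcT x hxT hcx⟩
    have hσa : tupleLexLT (σ c) a := by
      rcases ((hmemA' c).1 (Finset.mem_sdiff.1 hc).1).2 with h | ⟨h, h'⟩ | ⟨h, h'⟩
      · exact tupleLexLT_of_min_lt hmin (hσS c) ha (by rwa [hσm])
      · refine ⟨l, fun j hj => ?_, by rwa [hσl]⟩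
        by_cases hjm : j = m
        · subst hjm
          rw [hσm, h]
        · rw [hσmid c j hjm hj.ne]
      · obtain ⟨i, -, hi'⟩ := hcx
        have him : m = i := by
          by_contra him
          exact hm.ne' (h.symm.trans ((hi' m him).trans hxm))
        rw [hi' l (him ▸ hml.ne')] at h'
        exact absurd (hl.trans_le hxl) h'.not_gt
    refine Finset.mem_sdiff.2 ⟨hafirst _ (hσS c) hσa, fun hcY => ?_⟩
    refine irrefl_of tupleLexLT a (trans_of tupleLexLT
      (tupleLexLT_of_min_lt hmin ha (hσS c) ?_) hσa)
    rw [(hY _ hcY).2.1]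
    exact hm
  have e3 : edgeCount (cartesianProduct G) X' X' ≤ edgeCount (cartesianProduct G) X X :=
    edgeCount_le_edgeCount σ σ (fun x hx y hy h => hσinj x (hX x hx).1 y (hX y hy).1 h)
      (fun x hx y hy h => hσinj x (hX x hx).1 y (hX y hy).1 h)
      fun x hx y hy hxy => ⟨Finset.mem_image_of_mem _ hx, Finset.mem_image_of_mem _ hy,
        hσadj x (hX x hx).1 y (hX y hy).1 hxy⟩
  have e4 := hopt b A' B' hA'T hB'T hB'i hcard.symm
  have hdA : A' \ Y ∪ Y = A' := Finset.sdiff_union_of_subset Finset.sdiff_subset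
  have hdB : A' \ Y ∪ X' = B' := by
    ext x
    simp only [hYdef, hX', Finset.mem_union, Finset.mem_sdiff]
    tauto
  have hdX : Disjoint (A' \ Y) X' := Finset.disjoint_left.2 fun x hx hx' =>
    (Finset.mem_sdiff.1 hx').2 (Finset.mem_sdiff.1 hx).1
  -- The part `A' \ Y` common to `A'` and `B'` cancels, leaving only the edges that `Y` and `X'`
  -- contribute; `e1`, `e2` and `e3` transfer this comparison to `A`.
  rw [← hdA, edgeCount_union_self _ Finset.sdiff_disjoint, ← hdB,
    edgeCount_union_self _ hdX] at e4
  have hyB : ∀ y ∈ Y, y ∉ A \ Y ∪ X := fun y hy h => (Finset.mem_union.1 h).elim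
    (fun h => (Finset.mem_sdiff.1 h).2 hy) fun h => (hXmem y h).1 (hYA hy)
  refine ⟨A \ Y ∪ X, ?_, ?_, ?_, ?_, ?_⟩
  · intro x hx
    rcases Finset.mem_union.1 hx with h | h
    · exact hA (Finset.mem_sdiff.1 h).1
    · exact (hXmem x h).2.2
  · rw [Finset.card_union_of_disjoint hCX, hXcard, Finset.card_sdiff_add_card_eq_card hYA]
  · have : edgeCount (cartesianProduct G) A A =
        edgeCount (cartesianProduct G) (A \ Y ∪ Y) (A \ Y ∪ Y) := by
      rw [Finset.sdiff_union_of_subset hYA]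
    rw [this, edgeCount_union_self _ Finset.sdiff_disjoint, edgeCount_union_self _ hCX]
    omega
  · intro x hx hxA
    obtain ⟨y, hy⟩ := hYne
    have hxX : x ∈ X := (Finset.mem_union.1 hx).resolve_left fun h => hxA (Finset.mem_sdiff.1 h).1
    refine ⟨y, hYA hy, hyB y hy, tupleLexLT_of_min_lt hmin (hXmem x hxX).2.2 (hA (hYA hy)) ?_⟩
    rw [(hXmem x hxX).2.1, (hY y hy).2.1]
    exact hm
  · intro h
    obtain ⟨y, hy⟩ := hYne
    exact hyB y hy (h.symm.subset (hYA hy))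

/-- The extremal set that admits no exchange is compressed by `herase`; a gap in it would permit the
exchange given by `hpair`. So it is the initial segment of its size. -/
theorem isOptimalOn_slice_of_erase [Fintype ι] [∀ i, Fintype (V i)] {S : Finset ι} (hS : 3 ≤ S.card)
    (hpair : ∀ i j, i < j → ∀ q, IsOptimalOn (cartesianProduct G) tupleLexLT (slice {i, j} q))
    (herase : ∀ i ∈ S, ∀ q, IsOptimalOn (cartesianProduct G) tupleLexLT (slice (S.erase i) q))
    (p : ∀ i, V i) : IsOptimalOn (cartesianProduct G) tupleLexLT (slice S p) := by
  classical
  intro A₀ B hA₀ hB hBi hcard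
  obtain ⟨A, hAF, hmaxA, hex⟩ := exists_maximal_of_exchange tupleLexLT
    (Finset.univ.filter fun A : Finset (∀ i, V i) => ↑A ⊆ slice S p ∧ A.card = A₀.card)
    ⟨A₀, by simpa using hA₀⟩ fun A => edgeCount (cartesianProduct G) A A
  simp only [Finset.mem_filter, Finset.mem_univ, true_and, and_imp] at hAF hmaxA hex
  obtain ⟨hA, hAc⟩ := hAF
  have hcomp : ∀ i ∈ S, ∀ x ∈ slice S p, ∀ y ∈ A, tupleLexLT x y → x i = y i → x ∈ A :=
    fun i hi x hx y hy hxy hi' => isInitialIn_section_of_no_exchange hi (fun v => herase i hi _) hA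
      (fun B h1 h2 => hex B h1 (h2.trans hAc)) hx hy hxy hi'
  suffices hAi : IsInitialIn tupleLexLT (slice S p) A by
    have hAB := Finset.eq_of_subset_of_card_le
      (hAi.subset_of_card_le hBi hA hB (by omega)) (by omega)
    exact hAB ▸ hmaxA A₀ hA₀ rfl
  by_contra hAi
  unfold IsInitialIn at hAi
  push Not at hAi
  obtain ⟨x, hx, y, hy, hxy, hxA⟩ := hAi
  obtain ⟨a, ha, hafirst⟩ := (Finite.wellFounded_of_trans_of_irrefl
    (tupleLexLT (V := V))).has_min {x | x ∈ slice S p ∧ x ∉ A} ⟨x, hx, hxA⟩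
  have : IsTrans _ (Function.swap (tupleLexLT (V := V))) := 
    ⟨fun _ _ _ h h' => trans_of tupleLexLT h' h⟩
  have : Std.Irrefl (Function.swap (tupleLexLT (V := V))) := ⟨fun _ => irrefl_of tupleLexLT _⟩
  obtain ⟨b, hbA, hblast⟩ := (Finite.wellFounded_of_trans_of_irrefl
    (Function.swap (tupleLexLT (V := V)))).has_min ↑A ⟨y, hy⟩
  have hab : tupleLexLT a b :=
    trans_trichotomous_left (hafirst x ⟨hx, hxA⟩) (trans_trichotomous_right hxy (hblast y hy))
  have hne : S.Nonempty := Finset.card_pos.1 (by omega)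
  set m := S.min' hne with hm
  set l := S.max' hne with hl
  have hmS : m ∈ S := S.min'_mem hne
  have hlS : l ∈ S := S.max'_mem hne
  obtain ⟨k, hkS, hk⟩ := Finset.exists_mem_notMem_of_card_lt_card (s := {m, l}) (t := S)
    (lt_of_le_of_lt Finset.card_le_two (by omega))
  simp only [Finset.mem_insert, Finset.mem_singleton, not_or] at hk
  have hmin : ∀ i ∈ S, m ≤ i := fun i hi => S.min'_le i hi
  have hmax : ∀ i ∈ S, i ≤ l := fun i hi => S.le_max' i hi
  have hmk : m < k := lt_of_le_of_ne (hmin k hkS) (Ne.symm hk.1)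
  have hkl : k < l := lt_of_le_of_ne (hmax k hkS) hk.2
  obtain ⟨h1, h2, h3, h4⟩ := compressed_gap hmS hkS hlS hmin hmax hmk hkl hcomp ha.1 (hA hbA)
    ha.2 hbA hab
  obtain ⟨B, hB1, hB2, hB3, hB4, hB5⟩ := exists_exchange hmS hlS hmin hmax (hmk.trans hkl)
    (hpair m l (hmk.trans hkl)) hA hcomp ha.1 ha.2 hbA
    (fun z hz hza => by
      by_contra hzA
      exact hafirst z ⟨hz, hzA⟩ hza)
    (fun z hz => hblast z hz) h1 h2 h3 h4
  exact hB5 (hex B hB1 (hB2.trans hAc) hB3 hB4)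

theorem isOptimalOn_slice [Fintype ι] [∀ i, Fintype (V i)]
    (hpair : ∀ i j, i < j → ∀ q, IsOptimalOn (cartesianProduct G) tupleLexLT (slice {i, j} q))
    (S : Finset ι) (hS : 2 ≤ S.card) (p : ∀ i, V i) :
    IsOptimalOn (cartesianProduct G) tupleLexLT (slice S p) := by
  induction S using Finset.strongInduction generalizing p with
  | H S ih =>
    rcases hS.eq_or_lt with h | h
    · obtain ⟨i, j, hij, rfl⟩ := Finset.card_eq_two.1 h.symm
      rcases lt_or_gt_of_ne hij with hij | hij
      · exact hpair i j hij p
      · rw [Finset.pair_comm]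
        exact hpair j i hij p
    · refine isOptimalOn_slice_of_erase h hpair (fun i hi q => ?_) p
      refine ih _ (Finset.erase_ssubset hi) ?_ q
      rw [Finset.card_erase_of_mem hi]
      omega

end Exchange

/-! ### Subproducts as slices -/

section Subproduct

variable {ι : Type} [LinearOrder ι] {V : ι → Type u}

/-- The tuples indexed by `S`, extended by `p` outside of `S`. -/
def extendTuple (S : Finset ι) (p : ∀ i, V i) : (∀ i : S, V i) ↪ ∀ i, V i where
  toFun x i := if h : i ∈ S then x ⟨i, h⟩ else p i
  inj' x y hxy := by
    ext i
    simpa using congrFun hxy i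

theorem extendTuple_coe (S : Finset ι) (p : ∀ i, V i) (x : ∀ i : S, V i) (i : S) :
    extendTuple S p x i = x i :=
  dif_pos i.2

theorem extendTuple_of_notMem {S : Finset ι} (p : ∀ i, V i) (x : ∀ i : S, V i) {i : ι}
    (hi : i ∉ S) : extendTuple S p x i = p i :=
  dif_neg hi

theorem range_extendTuple (S : Finset ι) (p : ∀ i, V i) :
    Set.range (extendTuple S p) = slice S p := by
  ext x
  constructor
  · rintro ⟨y, rfl⟩ i hi
    exact extendTuple_of_notMem p y hi
  · intro hx
    refine ⟨fun i => x i, ?_⟩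
    ext i
    by_cases hi : i ∈ S
    · exact extendTuple_coe S p _ ⟨i, hi⟩
    · rw [extendTuple_of_notMem p _ hi, hx i hi]

theorem cartesianProduct_adj_extendTuple (G : ∀ i, SimpleGraph (V i)) (S : Finset ι)
    (p : ∀ i, V i) (x y : ∀ i : S, V i) :
    (cartesianProduct G).Adj (extendTuple S p x) (extendTuple S p y) ↔
      (subproduct G S).Adj x y := by
  constructor
  · rintro ⟨i, hi, hi'⟩
    have hiS : i ∈ S := by
      by_contra hiS
      rw [extendTuple_of_notMem p _ hiS, extendTuple_of_notMem p _ hiS] at hi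
      exact hi.ne rfl
    refine ⟨⟨i, hiS⟩, ?_, fun j hj => ?_⟩
    · simpa only [extendTuple_coe S p _ ⟨i, hiS⟩] using hi
    · simpa only [extendTuple_coe] using hi' j fun h => hj (Subtype.ext h)
  · rintro ⟨i, hi, hi'⟩
    refine ⟨i, by simpa only [extendTuple_coe] using hi, fun j hj => ?_⟩
    by_cases hjS : j ∈ S
    · have := hi' ⟨j, hjS⟩ fun h => hj (congrArg Subtype.val h)
      simpa only [extendTuple_coe S p _ ⟨j, hjS⟩] using this
    · rw [extendTuple_of_notMem p _ hjS, extendTuple_of_notMem p _ hjS]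

variable [∀ i, LinearOrder (V i)]

theorem tupleLexLT_extendTuple (S : Finset ι) (p : ∀ i, V i) (x y : ∀ i : S, V i) :
    tupleLexLT (extendTuple S p x) (extendTuple S p y) ↔ tupleLexLT x y := by
  constructor
  · rintro ⟨i, hi, hlt⟩
    have hiS : i ∈ S := by
      by_contra hiS
      rw [extendTuple_of_notMem p _ hiS, extendTuple_of_notMem p _ hiS] at hlt
      exact lt_irrefl _ hlt
    refine ⟨⟨i, hiS⟩, fun j hj => ?_, ?_⟩
    · simpa only [extendTuple_coe] using hi j hj
    · simpa only [extendTuple_coe S p _ ⟨i, hiS⟩] using hlt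
  · rintro ⟨i, hi, hlt⟩
    refine ⟨i, fun j hj => ?_, by simpa only [extendTuple_coe] using hlt⟩
    by_cases hjS : j ∈ S
    · simpa only [extendTuple_coe S p _ ⟨j, hjS⟩] using hi ⟨j, hjS⟩ hj
    · rw [extendTuple_of_notMem p _ hjS, extendTuple_of_notMem p _ hjS]

theorem isOptimalOn_slice_iff (G : ∀ i, SimpleGraph (V i)) (S : Finset ι) (p : ∀ i, V i) :
    IsOptimalOn (cartesianProduct G) tupleLexLT (slice S p) ↔
      IsOptimalOn (subproduct G S) tupleLexLT Set.univ := by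
  rw [← range_extendTuple]
  exact isOptimalOn_range_iff _ (cartesianProduct_adj_extendTuple G S p)
    (tupleLexLT_extendTuple S p)

end Subproduct

/-! ### The local-global principle and atomic partitions -/

section LocalGlobal

variable {ι : Type} [LinearOrder ι] {V : ι → Type u} [∀ i, Fintype (V i)]

theorem lexLT_eq_tupleLexLT [∀ i, LinearOrder (V i)] (η : ∀ i, VertexOrder (V i))
    (hη : ∀ i x y, x < y ↔ η i x < η i y) : lexLT η = tupleLexLT := by
  ext x y
  refine exists_congr fun i => and_congr (forall₂_congr fun j _ => ?_) ?_
  · simp only [position, Nat.cast_inj, add_left_inj, Fin.val_inj, EmbeddingLike.apply_eq_iff_eq]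
  · rw [hη]
    simp only [position, Nat.cast_lt, add_lt_add_iff_right, Fin.val_fin_lt]

theorem isOptimalOrder_of_isEmpty {α : Type*} [Fintype α] [IsEmpty α] (G : SimpleGraph α)
    (lt : α → α → Prop) : IsOptimalOrder G lt := by
  have : IsStrictTotalOrder α lt :=
    { trichotomous := fun x => isEmptyElim x
      irrefl := fun x => isEmptyElim x
      trans := fun x => isEmptyElim x }
  refine (isOptimalOrder_iff G lt).2 ⟨this, fun A B _ _ _ _ => ?_⟩
  rw [Finset.eq_empty_of_isEmpty A, Finset.eq_empty_of_isEmpty B]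

/-- The local-global principle for the lexicographic order. -/
theorem isOptimalOrder_lex_of_pairs [Fintype ι] (hι : 2 ≤ Fintype.card ι)
    (G : ∀ i, SimpleGraph (V i)) (η : ∀ i, VertexOrder (V i))
    (h : ∀ i j : ι, i < j → IsOptimalOrder (subproduct G {i, j}) (subLexLT η {i, j})) :
    IsOptimalOrder (subproduct G Finset.univ) (subLexLT η Finset.univ) ∧
      IsOptimalOrder (cartesianProduct G) (lexLT η) := by
  -- Slices need a base point `p`; if some factor is empty there is none, and optimality is trivial.
  rcases isEmpty_or_nonempty (∀ i, V i) with he | ⟨⟨p⟩⟩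
  · have : IsEmpty (∀ i : (Finset.univ : Finset ι), V i) :=
      ⟨fun x => he.false fun i => x ⟨i, Finset.mem_univ i⟩⟩
    exact ⟨isOptimalOrder_of_isEmpty _ _, isOptimalOrder_of_isEmpty _ _⟩
  · let _ : ∀ i, LinearOrder (V i) := fun i => LinearOrder.lift' (η i) (η i).injective
    have hsub : ∀ S : Finset ι, subLexLT η S = tupleLexLT := fun S =>
      lexLT_eq_tupleLexLT _ fun _ _ _ => Iff.rfl
    simp only [hsub, isOptimalOrder_iff] at h ⊢
    rw [lexLT_eq_tupleLexLT η fun _ _ _ => Iff.rfl]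
    have huniv : slice Finset.univ p = Set.univ :=
      Set.eq_univ_of_forall fun x i hi => absurd (Finset.mem_univ i) hi
    have key := isOptimalOn_slice (G := G)
      (fun i j hij q => (isOptimalOn_slice_iff G {i, j} q).2 (h i j hij).2) Finset.univ hι p
    refine ⟨⟨inferInstance, (isOptimalOn_slice_iff G _ p).1 key⟩, inferInstance, ?_⟩
    rwa [huniv] at key

theorem part_atomicPartition {W : Type u} [Fintype W] [DecidableEq W] (η : VertexOrder W) (v : W) :
    (atomicPartition η).part v = {v} := by
  have h : (atomicPartition η).part v ∈ (⊥ : Finpartition (Finset.univ : Finset W)).parts :=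
    (atomicPartition η).toFinpartition.part_mem.2 (Finset.mem_univ v)
  obtain ⟨w, -, hw⟩ := Finpartition.mem_bot_iff.1 h
  have hv : v ∈ (atomicPartition η).part v :=
    (atomicPartition η).toFinpartition.mem_part (Finset.mem_univ v)
  rw [← hw, Finset.mem_singleton] at hv
  rw [← hw, hv]

theorem start_atomicPartition {W : Type u} [Fintype W] [DecidableEq W] (η : VertexOrder W) (v : W) :
    (atomicPartition η).start v = v := by
  simp [IntervalPartition.start, part_atomicPartition]

theorem blockLexLT_atomicPartition [∀ i, DecidableEq (V i)] (η : ∀ i, VertexOrder (V i))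
    (D : (∀ i, Finset (V i)) → Equiv.Perm ι) :
    blockLexLT η (fun i => atomicPartition (η i)) D = lexLT η := by
  ext x y
  have hblock : block (fun i => atomicPartition (η i)) x = block (fun i => atomicPartition (η i)) y
      ↔ x = y := by
    simp [block, part_atomicPartition, funext_iff]
  have hstart : ∀ z, blockStart (fun i => atomicPartition (η i)) z = z := fun z =>
    funext fun i => start_atomicPartition _ _
  rw [blockLexLT, hblock, Ne, hblock, hstart, hstart]
  constructor
  · rintro (⟨rfl, i, -, hi⟩ | ⟨-, h⟩)
    · exact absurd hi (lt_irrefl _)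
    · exact h
  · intro h
    refine Or.inr ⟨?_, h⟩
    rintro rfl
    obtain ⟨i, -, hi⟩ := h
    exact lt_irrefl _ hi

end LocalGlobal

end EdgeIso

theorem mainTheorem2 {d : ℕ} (hd : 3 ≤ d) {V : Fin d → Type u}
    [∀ i, Fintype (V i)] [∀ i, DecidableEq (V i)]
    (G : ∀ i, SimpleGraph (V i)) (η : ∀ i, EdgeIso.VertexOrder (V i))
    (hη : ∀ i, EdgeIso.IsOptimalOrder (G i) (η i).lt)
    (D : ∀ S : Finset (Fin d), (∀ i : S, Finset (V i)) → Equiv.Perm S) :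
    (∀ S : Finset (Fin d), EdgeIso.atomicBlockLexLT η D S = EdgeIso.subLexLT η S) ∧
    ((∀ i j : Fin d, i < j →
        EdgeIso.IsOptimalOrder (EdgeIso.subproduct G {i, j})
          (EdgeIso.atomicBlockLexLT η D {i, j})) →
      EdgeIso.IsOptimalOrder (EdgeIso.subproduct G Finset.univ)
        (EdgeIso.atomicBlockLexLT η D Finset.univ)) ∧
    ((∀ i j : Fin d, i < j →
        EdgeIso.IsOptimalOrder (EdgeIso.subproduct G {i, j}) (EdgeIso.subLexLT η {i, j})) →
      EdgeIso.IsOptimalOrder (EdgeIso.cartesianProduct G) (EdgeIso.lexLT η)) := by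
  have hatomic : ∀ S, EdgeIso.atomicBlockLexLT η D S = EdgeIso.subLexLT η S := fun S =>
    EdgeIso.blockLexLT_atomicPartition _ _
  have hcard : 2 ≤ Fintype.card (Fin d) := by
    rw [Fintype.card_fin]
    omega
  refine ⟨hatomic, fun h => ?_, fun h => (EdgeIso.isOptimalOrder_lex_of_pairs hcard G η h).2⟩
  simp only [hatomic] at h ⊢
  exact (EdgeIso.isOptimalOrder_lex_of_pairs hcard G η h).1
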